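/- Let $\mathbb F$ be an algebraically closed field of characteristic $p\ge 0$ with $p\neq 2,3$. Let $A$ be a finite dimensional associative (not necessarily unital) algebra over $\mathbb F$ that is semisimple, i.e. its radical (the largest nilpotent two-sided ideal) is zero, so that $A$ is the direct sum of its simple components (its minimal non-zero two-sided ideals). Put $[x,y]=xy-yx$, $A^{(0)}=A$ and $A^{(k)}=[A^{(k-1)},A^{(k-1)}]$ (the span of commutators) for $k\ge 1$. A subspace $B$ of $A^{(k)}$ is a *Jordan-Lie inner ideal* of $A^{(k)}$ if $[B,[B,A^{(k)}]]\subseteq B$ and $B^2=0$, and it is a *regular inner ideal* of $A^{(k)}$ if $B^2=0$ and $BAB\subseteq B$. A pair $(e,f)$ of (possibly zero) idempotents of $A$ is a *strict orthogonal idempotent pair* if $ef=fe=0$ and, for every simple component $S$ of $A$, the projections of $e$ and $f$ on $S$ are either both zero or both non-zero. Let $k\ge 0$ and let $B$ be a subspace of $A$. Then $B$ is a Jordan-Lie inner ideal of $A^{(k)}$ if and only if $B=eAf$ for some strict orthogonal idempotent pair $(e,f)$ in $A$. Consequently, every Jordan-Lie inner ideal of $A^{(k)}$ is a regular inner ideal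 of $A^{(k)}$. -/

import Mathlib

/-! Jordan-Lie inner ideals of finite dimensional associative, possibly non-unital, algebras.
The commutator bracket on an associative ring is Mathlib's `⁅x, y⁆ = x * y - y * x`. -/

namespace JordanLie

section

variable {F A : Type*} [Field F] [NonUnitalRing A] [Module F A]

/-- The subspace `I` is a two-sided ideal of the algebra `A`. -/
def IsTwoSidedIdeal (I : Submodule F A) : Prop :=
  ∀ x ∈ I, ∀ a : A, a * x ∈ I ∧ x * a ∈ I

/-- `powSucc I n` is the power `I ^ (n + 1)`: the span of all products of `n + 1` elements
of `I`. (The algebra has no unit, so there is no zeroth power.) -/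
def powSucc (I : Submodule F A) : ℕ → Submodule F A
  | 0 => I
  | n + 1 => Submodule.span F {z | ∃ x ∈ powSucc I n, ∃ y ∈ I, z = x * y}

variable (F A) in
/-- The radical: the sum of all nilpotent two-sided ideals, which for a finite dimensional
algebra is the largest nilpotent two-sided ideal. -/
def radical : Submodule F A :=
  sSup {I | IsTwoSidedIdeal I ∧ ∃ n, powSucc I n = ⊥}

variable (F A) in
/-- An algebra (meant to be finite dimensional) is semisimple if its radical is zero. -/
def IsSemisimple : Prop := radical F A = ⊥

/-- `S` is a simple component of the semisimple algebra `A`, i.e. a minimal non-zero two-sided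
ideal. A semisimple algebra is the direct sum of its simple components. -/
def IsSimpleComponent (S : Submodule F A) : Prop :=
  IsTwoSidedIdeal S ∧ S ≠ ⊥ ∧ ∀ J : Submodule F A, IsTwoSidedIdeal J → J ≤ S → J = ⊥ ∨ J = S

/-- `y` is the projection of `x` on the simple component `S`: `y ∈ S`, and `x - y` lies in the sum
of the other simple components. -/
def IsProjection (S : Submodule F A) (x y : A) : Prop :=
  y ∈ S ∧ x - y ∈ sSup {T : Submodule F A | IsSimpleComponent T ∧ T ≠ S}

variable (F) in
/-- `(e, f)` is a strict orthogonal idempotent pair in the semisimple algebra `A`: `e` and `f` are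
idempotents (zero is allowed), `ef = fe = 0`, and for each simple component of `A` the projections
of `e` and `f` on it are both zero or both non-zero. -/
def IsStrictOrthogonalIdempotentPair (e f : A) : Prop :=
  e * e = e ∧ f * f = f ∧ e * f = 0 ∧ f * e = 0 ∧
    ∀ S : Submodule F A, IsSimpleComponent S →
      ∃ e' f' : A, IsProjection S e e' ∧ IsProjection S f f' ∧ (e' = 0 ↔ f' = 0)

variable (F A) in
/-- `A^(0) = A` and `A^(k+1) = [A^(k), A^(k)]` (the span of commutators), as subspaces of `A`. -/
def lieDerived : ℕ → Submodule F A
  | 0 => ⊤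
  | k + 1 => Submodule.span F {z | ∃ x ∈ lieDerived k, ∃ y ∈ lieDerived k, z = ⁅x, y⁆}

/-- `B` is an inner ideal of the Lie subalgebra `L` of `A`: `B ⊆ L` and `[B, [B, L]] ⊆ B`. -/
def IsInnerIdeal (L B : Submodule F A) : Prop :=
  B ≤ L ∧ ∀ b ∈ B, ∀ b' ∈ B, ∀ x ∈ L, ⁅b, ⁅b', x⁆⁆ ∈ B

/-- A Jordan-Lie inner ideal of `L`: an inner ideal `B` of `L` with `B² = 0`. -/
def IsJordanLieInnerIdeal (L B : Submodule F A) : Prop :=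
  IsInnerIdeal L B ∧ ∀ b ∈ B, ∀ b' ∈ B, b * b' = 0

/-- A regular inner ideal of `L` (with respect to `A`): a subspace `B` of `L` with `B² = 0` and
`BAB ⊆ B`. -/
def IsRegularInnerIdeal (L B : Submodule F A) : Prop :=
  B ≤ L ∧ (∀ b ∈ B, ∀ b' ∈ B, b * b' = 0) ∧ ∀ b ∈ B, ∀ a : A, ∀ b' ∈ B, b * a * b' ∈ B

end

end JordanLie

/-! ### Rank-one matrices and Jordan triple products -/

namespace JordanLie

/-! Since `B² = 0`, the double commutator `[b, [b', x]]` is `-(b x b' + b' x b)`. The right ideal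
`BA` is `e₀A` and the left ideal `AB` is `Af`, with `f e₀ = 0`; correcting `e₀` to `e = e₀ - e₀ f`
makes the idempotents orthogonal without changing their action on `B`. Only the part `f a e` of `a`
matters in `b a b'`, and it lies in every `A^(k)` (`corner_mem_lieDerived`), so `B` absorbs Jordan
triple products with all of `A`.

Over an algebraically closed field the unitization of `A` is a product of matrix algebras, where
rank-one matrices upgrade this to `BAB ⊆ B` (`mul_mul_mem_of_pi_matrix`). Hence `eAf ⊆ B`, while `b
= e b f` on `B`. Strictness holds because `e`, `f` and `B` lie in the same two-sided ideals. -/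

open Matrix in
/-- In a product of matrix algebras, a subspace `C` which is an inner ideal for the Jordan triple
product satisfies `C * A * C ⊆ C`. -/
theorem mul_mul_mem_of_pi_matrix {F ι : Type*} [Field F] (h2 : (2 : F) ≠ 0)
    [Fintype ι] [DecidableEq ι] {d : ι → ℕ}
    {C : Submodule F (Π i, Matrix (Fin (d i)) (Fin (d i)) F)}
    (hC : ∀ b ∈ C, ∀ b' ∈ C, ∀ u, b * u * b' + b' * u * b ∈ C)
    {b b' : Π i, Matrix (Fin (d i)) (Fin (d i)) F} (hb : b ∈ C) (hb' : b' ∈ C)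
    (u : Π i, Matrix (Fin (d i)) (Fin (d i)) F) : b * u * b' ∈ C := by
  have hsq : ∀ c ∈ C, ∀ u, c * u * c ∈ C := fun c hc u => by
    have h := C.smul_mem (2⁻¹ : F) (hC c hc c hc u)
    rwa [← two_smul F, smul_smul, inv_mul_cancel₀ h2, one_smul] at h
  let s (i : ι) (v φ : Fin (d i) → F) : Π i, Matrix (Fin (d i)) (Fin (d i)) F :=
    Pi.single i (vecMulVec v φ)
  have hs : ∀ (c c' : Π i, Matrix (Fin (d i)) (Fin (d i)) F) i v φ,
      c * s i v φ * c' = s i (c i *ᵥ v) (φ ᵥ* c' i) := by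
    intro c c' i v φ
    funext j
    by_cases hj : j = i
    · subst hj
      simp [s, mul_vecMulVec, vecMulVec_mul]
    · simp [s, hj]
  have key : ∀ i v φ, s i (b i *ᵥ v) (φ ᵥ* b' i) ∈ C := by
    intro i v φ
    set x := b i *ᵥ v with hx
    set ψ := φ ᵥ* b' i with hψ
    by_cases hx0 : x = 0
    · simp [s, hx0]
    by_cases hψ0 : ψ = 0
    · simp [s, hψ0]
    obtain ⟨j, hj⟩ : ∃ j, x j ≠ 0 := by
      by_contra! h
      exact hx0 (funext h)
    obtain ⟨l, hl⟩ : ∃ l, ψ l ≠ 0 := by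
      by_contra! h
      exact hψ0 (funext h)
    -- `η` is a row of `b i` with `η ⬝ᵥ v = x j`, and `y` a column of `b' i` with `φ ⬝ᵥ y = ψ l`;
    -- both values are non-zero.
    set η := Pi.single j (1 : F) ᵥ* b i with hη
    set y := b' i *ᵥ Pi.single l (1 : F) with hy
    have hηv : η ⬝ᵥ v ≠ 0 := by
      rw [hη, ← dotProduct_mulVec, ← hx]
      simpa using hj
    have hφy : φ ⬝ᵥ y ≠ 0 := by
      rw [hy, dotProduct_mulVec, ← hψ]
      simpa using hl
    have h1 : s i x η ∈ C := by
      rw [hx, hη, ← hs]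
      exact hsq b hb _
    have h2 : s i y ψ ∈ C := by
      rw [hy, hψ, ← hs]
      exact hsq b' hb' _
    by_cases hxy : y ∈ Submodule.span F {x}
    · obtain ⟨c, hc⟩ := Submodule.mem_span_singleton.1 hxy
      have hc0 : c ≠ 0 := by
        rintro rfl
        rw [zero_smul] at hc
        simp [← hc] at hφy
      have : s i x ψ = c⁻¹ • s i y ψ := by
        simp only [s]
        rw [← hc, smul_vecMulVec, Pi.single_smul, smul_smul, inv_mul_cancel₀ hc0, one_smul]
      rw [this]
      exact C.smul_mem _ h2
    -- A functional killing `x` but not `y` annihilates one of the two terms of the triple product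
    -- and leaves a non-zero multiple of `s i x ψ`.
    · obtain ⟨ρ, hρy, hρx⟩ := Submodule.exists_le_ker_of_notMem hxy
      obtain ⟨r, hr⟩ : ∃ r : Fin (d i) → F, ∀ z, ρ z = r ⬝ᵥ z :=
        ⟨fun k => ρ (Pi.single k 1), fun z => by
          conv_lhs => rw [← Finset.univ_sum_single z]
          rw [map_sum, dotProduct]
          refine Finset.sum_congr rfl fun k _ => ?_
          have : (Pi.single k (z k) : Fin (d i) → F) = z k • Pi.single k 1 := by
            rw [← Pi.single_smul', smul_eq_mul, mul_one]
          rw [this, map_smul, smul_eq_mul, mul_comm]⟩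
      have hrx : r ⬝ᵥ x = 0 := by
        rw [← hr]
        exact hρx (Submodule.mem_span_singleton_self x)
      rw [hr] at hρy
      have h := hC _ h1 _ h2 (s i v r)
      rw [hs, hs] at h
      have e : s i (s i x η i *ᵥ v) (r ᵥ* s i y ψ i) + s i (s i y ψ i *ᵥ v) (r ᵥ* s i x η i)
          = ((η ⬝ᵥ v) * (r ⬝ᵥ y)) • s i x ψ := by
        simp only [s, Pi.single_eq_same, vecMulVec_mulVec, vecMul_vecMulVec, hrx]
        simp [smul_vecMulVec, vecMulVec_smul, Pi.single_smul, smul_smul, mul_comm]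
      rw [e] at h
      have h' := C.smul_mem ((η ⬝ᵥ v) * (r ⬝ᵥ y))⁻¹ h
      rwa [smul_smul, inv_mul_cancel₀ (mul_ne_zero hηv hρy), one_smul] at h'
  have hu : u = ∑ i, ∑ j, ∑ k, u i j k • s i (Pi.single j 1) (Pi.single k 1) := by
    conv_lhs => rw [← Finset.univ_sum_single u]
    refine Finset.sum_congr rfl fun i _ => ?_
    conv_lhs => rw [matrix_eq_sum_single (u i)]
    simp only [s, ← Pi.single_smul, ← single_eq_single_vecMulVec_single, smul_single, smul_eq_mul,
      mul_one]
    simp only [← AddMonoidHom.single_apply, map_sum]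
  rw [hu]
  simp only [Finset.mul_sum, Finset.sum_mul, mul_smul_comm, smul_mul_assoc, hs]
  exact Submodule.sum_mem _ fun i _ => Submodule.sum_mem _ fun j _ => Submodule.sum_mem _
    fun k _ => C.smul_mem _ (key _ _ _)

end JordanLie
-- Idempotent generators of ideals, via the unitization
namespace JordanLie

section Structure

variable {F A : Type*} [Field F] [NonUnitalRing A] [Module F A]

theorem finiteDimensional_unitization [FiniteDimensional F A] :
    FiniteDimensional F (Unitization F A) :=
  Module.Finite.equiv (Unitization.linearEquiv F F A).symm

theorem unitization_mul_inr (u : Unitization F A) (a : A) :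
    u * (a : Unitization F A) = ((u.fst • a + u.snd * a : A) : Unitization F A) := by
  ext <;> simp

theorem unitization_inr_mul (u : Unitization F A) (a : A) :
    (a : Unitization F A) * u = ((u.fst • a + a * u.snd : A) : Unitization F A) := by
  ext <;> simp

variable [IsScalarTower F A A] [SMulCommClass F A A]

/-- The unitization of a finite dimensional algebra with zero radical is semisimple. -/
theorem isSemisimpleRing_unitization [FiniteDimensional F A] (hA : IsSemisimple F A) :
    IsSemisimpleRing (Unitization F A) := by
  have := finiteDimensional_unitization (F := F) (A := A)
  have : IsArtinianRing (Unitization F A) := IsArtinianRing.of_finite F _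
  rw [IsArtinianRing.isSemisimpleRing_iff_jacobson, ← Ideal.jacobson_bot]
  obtain ⟨n, hn⟩ := IsArtinianRing.isNilpotent_jacobson_bot (R := Unitization F A)
  set J := Ideal.jacobson (⊥ : Ideal (Unitization F A))
  let I : Submodule F A := (J.restrictScalars F).comap (Unitization.inrHom F F A)
  have hI : ∀ x, x ∈ I ↔ (x : Unitization F A) ∈ J := fun x => Iff.rfl
  have hI2 : IsTwoSidedIdeal I := by
    intro x hx a
    rw [hI] at hx
    rw [hI, hI, Unitization.inr_mul, Unitization.inr_mul]
    exact ⟨J.mul_mem_left _ hx, J.mul_mem_right _ hx⟩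
  have hpow : ∀ m, ∀ x ∈ powSucc I m, (x : Unitization F A) ∈ J ^ (m + 1) := by
    intro m
    induction m with
    | zero =>
      intro x hx
      rw [zero_add, Submodule.pow_one]
      exact hx
    | succ m ih =>
      intro x hx
      have : powSucc I (m + 1) ≤
          ((J ^ (m + 1 + 1)).restrictScalars F).comap (Unitization.inrHom F F A) := by
        refine Submodule.span_le.2 ?_
        rintro _ ⟨y, hy, z, hz, rfl⟩
        change ((y * z : A) : Unitization F A) ∈ J ^ (m + 1 + 1)
        rw [Unitization.inr_mul, Submodule.pow_succ]
        exact Ideal.mul_mem_mul (ih y hy) hz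
      exact this hx
  have hIbot : I = ⊥ := by
    have h : I ≤ radical F A := by
      refine le_sSup ⟨hI2, n, ?_⟩
      rw [eq_bot_iff]
      intro x hx
      have := hpow n x hx
      rw [Submodule.pow_succ, hn, Ideal.zero_eq_bot, Submodule.bot_mul] at this
      exact Unitization.inr_injective (this.trans (Unitization.inr_zero F).symm)
    rw [show radical F A = ⊥ from hA] at h
    exact le_bot_iff.1 h
  rw [eq_bot_iff]
  intro x hx
  -- The scalar part of a nilpotent element is a nilpotent scalar, so `J` lies inside `A`.
  have hx0 : x.fst = 0 := by
    have h := Ideal.pow_mem_pow hx n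
    rw [hn] at h
    have h1 : (Unitization.fstHom F A x) ^ n = 0 := by
      rw [← map_pow, show x ^ n = 0 from h, map_zero]
    exact eq_zero_of_pow_eq_zero h1
  have hx1 : x = (x.snd : Unitization F A) := by
    ext <;> simp [hx0]
  have : x.snd ∈ I := by
    rw [hI, ← hx1]
    exact hx
  rw [hIbot, Submodule.mem_bot] at this
  rw [hx1, this]
  simp

variable [FiniteDimensional F A]

/-- Left ideals of a semisimple algebra are generated by idempotents. -/
theorem exists_idempotent_of_left (hA : IsSemisimple F A) (I : Submodule F A)
    (hI : ∀ a, ∀ x ∈ I, a * x ∈ I) : ∃ f ∈ I, f * f = f ∧ ∀ x ∈ I, x * f = x := by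
  have := isSemisimpleRing_unitization hA
  let K : Ideal (Unitization F A) :=
    { I.map (Unitization.inrHom F F A) with
      smul_mem' := by
        rintro u _ ⟨x, hx, rfl⟩
        refine ⟨u.fst • x + u.snd * x, I.add_mem (I.smul_mem _ hx) (hI _ _ hx), ?_⟩
        exact (unitization_mul_inr u x).symm }
  obtain ⟨e, he, hK⟩ := IsSemisimpleRing.ideal_eq_span_idempotent K
  have heK : e ∈ K := hK ▸ Ideal.mem_span_singleton_self e
  obtain ⟨f, hf, rfl⟩ := heK
  have h1 : ∀ x ∈ I, x * f = x := by
    intro x hx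
    have hxK : (x : Unitization F A) ∈ K := ⟨x, hx, rfl⟩
    rw [hK, Ideal.mem_span_singleton'] at hxK
    obtain ⟨u, hu⟩ := hxK
    apply Unitization.inr_injective (R := F)
    rw [Unitization.inr_mul, ← hu, mul_assoc]
    exact congrArg (u * ·) he
  exact ⟨f, hf, h1 f hf, h1⟩

/-- Right ideals of a semisimple algebra are generated by idempotents. -/
theorem exists_idempotent_of_right (hA : IsSemisimple F A) (I : Submodule F A)
    (hI : ∀ a, ∀ x ∈ I, x * a ∈ I) : ∃ e ∈ I, e * e = e ∧ ∀ x ∈ I, e * x = x := by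
  have := isSemisimpleRing_unitization hA
  let K : Ideal (Unitization F A)ᵐᵒᵖ :=
    { carrier := {u | ∃ x ∈ I, u = MulOpposite.op (x : Unitization F A)}
      add_mem' := by
        rintro _ _ ⟨x, hx, rfl⟩ ⟨y, hy, rfl⟩
        exact ⟨x + y, I.add_mem hx hy, by simp⟩
      zero_mem' := ⟨0, I.zero_mem, by simp⟩
      smul_mem' := by
        rintro u _ ⟨x, hx, rfl⟩
        refine ⟨u.unop.fst • x + x * u.unop.snd, I.add_mem (I.smul_mem _ hx) (hI _ _ hx), ?_⟩
        rw [← unitization_inr_mul, smul_eq_mul, MulOpposite.op_mul, MulOpposite.op_unop] }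
  obtain ⟨e, he, hK⟩ := IsSemisimpleRing.ideal_eq_span_idempotent K
  have heK : e ∈ K := hK ▸ Ideal.mem_span_singleton_self e
  obtain ⟨f, hf, rfl⟩ := heK
  have h1 : ∀ x ∈ I, f * x = x := by
    intro x hx
    have hxK : MulOpposite.op (x : Unitization F A) ∈ K := ⟨x, hx, rfl⟩
    rw [hK, Ideal.mem_span_singleton'] at hxK
    obtain ⟨u, hu⟩ := hxK
    apply Unitization.inr_injective (R := F)
    apply MulOpposite.op_injective
    rw [Unitization.inr_mul, MulOpposite.op_mul, ← hu, mul_assoc]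
    exact congrArg (u * ·) he
  exact ⟨f, hf, h1 f hf, h1⟩

/-- Two-sided ideals of a semisimple algebra have a unit, which is central in the algebra. -/
theorem IsTwoSidedIdeal.exists_unit (hA : IsSemisimple F A) {I : Submodule F A}
    (hI : IsTwoSidedIdeal I) :
    ∃ e ∈ I, (∀ x ∈ I, e * x = x ∧ x * e = x) ∧ ∀ a, e * a = a * e := by
  obtain ⟨f, hf, -, hf'⟩ := exists_idempotent_of_left hA I fun a x hx => (hI x hx a).1
  obtain ⟨e, he, -, he'⟩ := exists_idempotent_of_right hA I fun a x hx => (hI x hx a).2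
  obtain rfl : f = e := (he' f hf).symm.trans (hf' e he)
  refine ⟨f, hf, fun x hx => ⟨he' x hx, hf' x hx⟩, fun a => ?_⟩
  rw [← hf' (f * a) (hI f hf a).2, mul_assoc, he' (a * f) (hI f hf a).1]

/-- Semisimple algebras are von Neumann regular. -/
theorem exists_mul_mul_eq_self (hA : IsSemisimple F A) (x : A) : ∃ y, x * y * x = x := by
  obtain ⟨u, -, hu, -⟩ := IsTwoSidedIdeal.exists_unit hA (I := (⊤ : Submodule F A))
    fun x _ a => ⟨trivial, trivial⟩
  obtain ⟨f, ⟨y, rfl⟩, -, hf⟩ := exists_idempotent_of_left hA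
    (LinearMap.range (LinearMap.mulRight F x)) (by
      rintro a _ ⟨y, rfl⟩
      exact ⟨a * y, by simp [mul_assoc]⟩)
  refine ⟨y, ?_⟩
  rw [mul_assoc]
  exact hf x ⟨u, (hu x trivial).1⟩

end Structure

end JordanLie
-- Inner ideals and Peirce corners
namespace JordanLie

section InnerIdeals

variable {F A : Type*} [Field F] [NonUnitalRing A] [Module F A]

theorem lieDerived_succ_le (k : ℕ) : lieDerived F A (k + 1) ≤ lieDerived F A k := by
  induction k with
  | zero => exact le_top
  | succ k ih =>
    refine Submodule.span_mono ?_
    rintro _ ⟨x, hx, y, hy, rfl⟩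
    exact ⟨x, ih hx, y, ih hy, rfl⟩

/-- The bridge from Lie inner ideals to Jordan triple products: the terms containing `b b'` or `b'
b` vanish. -/
theorem lie_lie_of_mul_eq_zero {b b' : A} (h : b * b' = 0) (h' : b' * b = 0) (x : A) :
    ⁅b, ⁅b', x⁆⁆ = -(b * x * b' + b' * x * b) := by
  have h1 : b * (b' * x) = 0 := by rw [← mul_assoc, h, zero_mul]
  have h2 : x * b' * b = 0 := by rw [mul_assoc, h', mul_zero]
  simp only [Ring.lie_def, mul_sub, sub_mul, h1, h2, ← mul_assoc]
  abel

theorem corner_mul_corner {e f : A} (hfe : f * e = 0) (a b : A) :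
    e * a * f * (e * b * f) = 0 := by
  rw [mul_assoc e b f, mul_assoc (e * a), ← mul_assoc f, hfe, zero_mul, mul_zero]

variable [IsScalarTower F A A] [SMulCommClass F A A] [FiniteDimensional F A]

/-- The off-diagonal Peirce components of a pair of orthogonal idempotents lie in every `A^(k)`. -/
theorem corner_mem_lieDerived (hA : IsSemisimple F A) (h2 : (2 : F) ≠ 0) (k : ℕ) :
    ∀ {e f : A}, e * e = e → f * f = f → e * f = 0 → f * e = 0 →
      ∀ a, e * a * f ∈ lieDerived F A k := by
  induction k with
  | zero => intros; trivial
  | succ k ih =>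
    intro e f he hf hef hfe a
    obtain ⟨y, hy⟩ := exists_mul_mul_eq_self hA (e * a * f)
    set x := e * a * f with hx
    have hex : e * x = x := by rw [hx, ← mul_assoc, ← mul_assoc, he]
    have hxf : x * f = x := by rw [hx, mul_assoc, hf]
    have hxx : x * x = 0 := corner_mul_corner hfe a a
    set z := f * y * e with hz
    have hxzx : x * z * x = x := by
      rw [hz, ← mul_assoc x, ← mul_assoc x, hxf, mul_assoc, hex, hy]
    have hxk : x ∈ lieDerived F A k := ih he hf hef hfe a
    have hzk : z ∈ lieDerived F A k := ih hf he hfe hef y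
    -- As in an `sl₂`-triple: `x z x = x` and `x² = 0`, so `x` is half a double commutator of
    -- elements of `A^(k)`.
    have hlie : ⁅⁅x, z⁆, x⁆ = (2 : F) • x := by
      rw [two_smul]
      nth_rewrite 4 [← hxzx]
      nth_rewrite 3 [← hxzx]
      have h3 : z * x * x = 0 := by rw [mul_assoc, hxx, mul_zero]
      simp only [Ring.lie_def, mul_sub, sub_mul, h3, ← mul_assoc]
      rw [hxx, zero_mul]
      abel
    have hmem : ⁅⁅x, z⁆, x⁆ ∈ lieDerived F A (k + 1) :=
      Submodule.subset_span ⟨⁅x, z⁆,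
        lieDerived_succ_le k (Submodule.subset_span ⟨x, hxk, z, hzk, rfl⟩), x, hxk, rfl⟩
    rw [hlie] at hmem
    have := Submodule.smul_mem _ (2⁻¹ : F) hmem
    rwa [smul_smul, inv_mul_cancel₀ h2, one_smul] at this

/-- Over an algebraically closed field, a subspace of a semisimple algebra that is an inner ideal
for the Jordan triple product `b a b' + b' a b` satisfies `B * A * B ⊆ B`. -/
theorem mul_mul_mem_of_triple [IsAlgClosed F] (hA : IsSemisimple F A) (h2 : (2 : F) ≠ 0)
    {B : Submodule F A} (hB : ∀ b ∈ B, ∀ b' ∈ B, ∀ a, b * a * b' + b' * a * b ∈ B)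
    {b b' : A} (hb : b ∈ B) (hb' : b' ∈ B) (a : A) : b * a * b' ∈ B := by
  have := isSemisimpleRing_unitization hA
  have := finiteDimensional_unitization (F := F) (A := A)
  obtain ⟨n, d, -, ⟨φ⟩⟩ :=
    IsSemisimpleRing.exists_algEquiv_pi_matrix_of_isAlgClosed F (Unitization F A)
  obtain ⟨ε, -, hε, -⟩ := IsTwoSidedIdeal.exists_unit hA (I := (⊤ : Submodule F A))
    fun x _ a => ⟨trivial, trivial⟩
  let ψ : A →ₗ[F] Π i, Matrix (Fin (d i)) (Fin (d i)) F :=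
    φ.toLinearMap ∘ₗ Unitization.inrHom F F A
  have hψ : ∀ x, ψ x = φ (x : Unitization F A) := fun x => rfl
  have hψinj : Function.Injective ψ := φ.injective.comp Unitization.inr_injective
  have key : ∀ b ∈ B.map ψ, ∀ b' ∈ B.map ψ, ∀ u, b * u * b' + b' * u * b ∈ B.map ψ := by
    rintro _ ⟨b, hb, rfl⟩ _ ⟨b', hb', rfl⟩ u
    obtain ⟨u, rfl⟩ := φ.surjective u
    -- This element of `A` is `ε u`; it can replace `u` because `c ε = c` for `c` in `A`.
    refine ⟨_, hB b hb b' hb' (u.fst • ε + ε * u.snd), ?_⟩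
    have : ∀ c c' : A, ((c * (u.fst • ε + ε * u.snd) * c' : A) : Unitization F A) = c * u * c' := by
      intro c c'
      rw [Unitization.inr_mul, Unitization.inr_mul, ← unitization_inr_mul, ← mul_assoc,
        ← Unitization.inr_mul, (hε c trivial).2]
    rw [map_add, hψ, hψ, this, this]
    simp only [map_mul, hψ]
  obtain ⟨x, hx, hxe⟩ := mul_mul_mem_of_pi_matrix h2 key ⟨b, hb, rfl⟩ ⟨b', hb', rfl⟩ (ψ a)
  have : ψ x = ψ (b * a * b') := by
    rw [hxe]
    simp only [hψ, Unitization.inr_mul, map_mul]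
  rwa [← hψinj this]

/-- A Jordan-Lie inner ideal of `A^(k)` is a corner `e A f` generated by itself on both sides. -/
theorem IsJordanLieInnerIdeal.exists_corner [IsAlgClosed F] (hA : IsSemisimple F A)
    (h2 : (2 : F) ≠ 0) {k : ℕ} {B : Submodule F A}
    (hB : IsJordanLieInnerIdeal (lieDerived F A k) B) :
    ∃ e f : A, e * e = e ∧ f * f = f ∧ e * f = 0 ∧ f * e = 0 ∧
      (∀ I : Submodule F A, IsTwoSidedIdeal I → B ≤ I → e ∈ I ∧ f ∈ I) ∧
      (B : Set A) = {x | ∃ a : A, x = e * a * f} := by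
  obtain ⟨⟨-, hin⟩, hsq⟩ := hB
  obtain ⟨e₀, he₀, -, he₀B⟩ := exists_idempotent_of_right hA
    (Submodule.span F {x | ∃ b ∈ B, ∃ a, x = b * a}) (by
      intro a x hx
      have : Submodule.span F {x | ∃ b ∈ B, ∃ a, x = b * a} ≤
          (Submodule.span F {x | ∃ b ∈ B, ∃ a, x = b * a}).comap (LinearMap.mulRight F a) := by
        refine Submodule.span_le.2 ?_
        rintro _ ⟨b, hb, c, rfl⟩
        exact Submodule.subset_span ⟨b, hb, c * a, mul_assoc _ _ _⟩
      exact this hx)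
  obtain ⟨f, hf, hff, hfB⟩ := exists_idempotent_of_left hA
    (Submodule.span F {x | ∃ b ∈ B, ∃ a, x = a * b}) (by
      intro a x hx
      have : Submodule.span F {x | ∃ b ∈ B, ∃ a, x = a * b} ≤
          (Submodule.span F {x | ∃ b ∈ B, ∃ a, x = a * b}).comap (LinearMap.mulLeft F a) := by
        refine Submodule.span_le.2 ?_
        rintro _ ⟨b, hb, c, rfl⟩
        exact Submodule.subset_span ⟨b, hb, a * c, (mul_assoc _ _ _).symm⟩
      exact this hx)
  -- Without a unit, `b ∈ BA` and `b ∈ AB` come from `b = b y b`.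
  have hreg : ∀ b ∈ B, e₀ * b = b ∧ b * f = b := by
    intro b hb
    obtain ⟨y, hy⟩ := exists_mul_mul_eq_self hA b
    exact ⟨he₀B b (Submodule.subset_span ⟨b, hb, y * b, by rw [← mul_assoc, hy]⟩),
      hfB b (Submodule.subset_span ⟨b, hb, b * y, hy.symm⟩)⟩
  have hfb : ∀ b ∈ B, f * b = 0 := by
    intro b hb
    have : Submodule.span F {x | ∃ b ∈ B, ∃ a, x = a * b} ≤
        LinearMap.ker (LinearMap.mulRight F b) := by
      refine Submodule.span_le.2 ?_
      rintro _ ⟨c, hc, a, rfl⟩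
      simp [mul_assoc, hsq c hc b hb]
    exact this hf
  have hfe₀ : f * e₀ = 0 := by
    have : Submodule.span F {x | ∃ b ∈ B, ∃ a, x = b * a} ≤
        LinearMap.ker (LinearMap.mulLeft F f) := by
      refine Submodule.span_le.2 ?_
      rintro _ ⟨c, hc, a, rfl⟩
      simp [← mul_assoc, hfb c hc]
    exact this he₀
  have he₀e₀ : e₀ * e₀ = e₀ := he₀B e₀ he₀
  set e := e₀ - e₀ * f with he
  have hee : e * e = e := by
    simp only [he, mul_sub, sub_mul, he₀e₀]
    rw [mul_assoc e₀ f, hfe₀, mul_assoc e₀ f, ← mul_assoc f, hfe₀, ← mul_assoc, he₀e₀]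
    simp
  have hef : e * f = 0 := by rw [he, sub_mul, mul_assoc, hff, sub_self]
  have hfe : f * e = 0 := by rw [he, mul_sub, ← mul_assoc, hfe₀, zero_mul, sub_self]
  have heb : ∀ b ∈ B, e * b = b := by
    intro b hb
    rw [he, sub_mul, mul_assoc, hfb b hb, mul_zero, sub_zero, (hreg b hb).1]
  have htri : ∀ b ∈ B, ∀ b' ∈ B, ∀ a, b * a * b' + b' * a * b ∈ B := by
    intro b hb b' hb' a
    have h := hin b hb b' hb' (f * a * e) (corner_mem_lieDerived hA h2 k hff hee hfe hef a)
    rw [lie_lie_of_mul_eq_zero (hsq b hb b' hb') (hsq b' hb' b hb)] at h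
    have hc : ∀ c ∈ B, ∀ c' ∈ B, c * (f * a * e) * c' = c * a * c' := by
      intro c hc c' hc'
      rw [← mul_assoc, ← mul_assoc, (hreg c hc).2, mul_assoc, heb c' hc']
    rw [hc b hb b' hb', hc b' hb' b hb] at h
    exact neg_mem_iff.1 h
  have hBAB : ∀ b ∈ B, ∀ b' ∈ B, ∀ a, b * a * b' ∈ B := fun b hb b' hb' a =>
    mul_mul_mem_of_triple hA h2 htri hb hb' a
  refine ⟨e, f, hee, hff, hef, hfe, ?_, ?_⟩
  · intro I hI hBI
    have h1 : e₀ ∈ I := by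
      refine Submodule.span_le.2 ?_ he₀
      rintro _ ⟨b, hb, a, rfl⟩
      exact (hI b (hBI hb) a).2
    refine ⟨I.sub_mem h1 (hI e₀ h1 f).2, ?_⟩
    refine Submodule.span_le.2 ?_ hf
    rintro _ ⟨b, hb, a, rfl⟩
    exact (hI b (hBI hb) a).1
  · ext x
    constructor
    · intro hx
      exact ⟨x, by rw [heb x hx, (hreg x hx).2]⟩
    · rintro ⟨a, rfl⟩
      have h1 : ∀ b ∈ B, ∀ c, b * c * f ∈ B := by
        intro b hb c
        have : Submodule.span F {x | ∃ b ∈ B, ∃ a, x = a * b} ≤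
            B.comap (LinearMap.mulLeft F (b * c)) := by
          refine Submodule.span_le.2 ?_
          rintro _ ⟨b', hb', a, rfl⟩
          change b * c * (a * b') ∈ B
          rw [← mul_assoc, mul_assoc b]
          exact hBAB b hb b' hb' _
        exact this hf
      have h2 : ∀ c, e₀ * c * f ∈ B := by
        intro c
        have : Submodule.span F {x | ∃ b ∈ B, ∃ a, x = b * a} ≤
            B.comap (LinearMap.mulRight F (c * f)) := by
          refine Submodule.span_le.2 ?_
          rintro _ ⟨b, hb, a, rfl⟩
          change b * a * (c * f) ∈ B
          rw [← mul_assoc, mul_assoc b]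
          exact h1 b hb _
        have h := this he₀
        rwa [Submodule.mem_comap, LinearMap.mulRight_apply, ← mul_assoc] at h
      have : e * a * f = e₀ * (a - f * a) * f := by
        simp only [he, mul_sub, sub_mul, mul_assoc]
      rw [this]
      exact h2 _

/-- The corner `e A f` of orthogonal idempotents is a Jordan-Lie inner ideal. -/
theorem isJordanLieInnerIdeal_of_corner (hA : IsSemisimple F A) (h2 : (2 : F) ≠ 0) (k : ℕ)
    {B : Submodule F A} {e f : A} (he : e * e = e) (hf : f * f = f) (hef : e * f = 0)
    (hfe : f * e = 0) (hB : (B : Set A) = {x | ∃ a : A, x = e * a * f}) :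
    IsJordanLieInnerIdeal (lieDerived F A k) B ∧
      IsRegularInnerIdeal (lieDerived F A k) B := by
  have hmem : ∀ x, x ∈ B ↔ ∃ a, x = e * a * f := fun x => Set.ext_iff.1 hB x
  have hle : B ≤ lieDerived F A k := by
    intro x hx
    obtain ⟨a, rfl⟩ := (hmem x).1 hx
    exact corner_mem_lieDerived hA h2 k he hf hef hfe a
  have hsq : ∀ b ∈ B, ∀ b' ∈ B, b * b' = 0 := by
    intro b hb b' hb'
    obtain ⟨a, rfl⟩ := (hmem b).1 hb
    obtain ⟨a', rfl⟩ := (hmem b').1 hb'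
    exact corner_mul_corner hfe a a'
  have hBAB : ∀ b ∈ B, ∀ a : A, ∀ b' ∈ B, b * a * b' ∈ B := by
    intro b hb c b' hb'
    obtain ⟨a, rfl⟩ := (hmem b).1 hb
    obtain ⟨a', rfl⟩ := (hmem b').1 hb'
    exact (hmem _).2 ⟨a * f * c * e * a', by simp only [mul_assoc]⟩
  refine ⟨⟨⟨hle, fun b hb b' hb' x _ => ?_⟩, hsq⟩, hle, hsq, hBAB⟩
  rw [lie_lie_of_mul_eq_zero (hsq b hb b' hb') (hsq b' hb' b hb)]
  exact B.neg_mem (B.add_mem (hBAB b hb x b' hb') (hBAB b' hb' x b hb))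

end InnerIdeals

/-! ### Simple components and projections -/

section Components

variable {F A : Type*} [Field F] [NonUnitalRing A] [Module F A]

theorem isTwoSidedIdeal_sSup [IsScalarTower F A A] [SMulCommClass F A A]
    {s : Set (Submodule F A)} (hs : ∀ I ∈ s, IsTwoSidedIdeal I) :
    IsTwoSidedIdeal (sSup s) := by
  intro x hx a
  have h1 : sSup s ≤ (sSup s).comap (LinearMap.mulLeft F a) :=
    sSup_le fun I hI y hy => (le_sSup hI : I ≤ sSup s) (hs I hI y hy a).1
  have h2 : sSup s ≤ (sSup s).comap (LinearMap.mulRight F a) :=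
    sSup_le fun I hI y hy => (le_sSup hI : I ≤ sSup s) (hs I hI y hy a).2
  exact ⟨h1 hx, h2 hx⟩

variable [FiniteDimensional F A]

theorem exists_isSimpleComponent_le {J : Submodule F A} (hJ : IsTwoSidedIdeal J) (hJ0 : J ≠ ⊥) :
    ∃ S, IsSimpleComponent S ∧ S ≤ J := by
  obtain ⟨S, ⟨hS, hS0, hSJ⟩, hmin⟩ := (wellFounded_lt (α := Submodule F A)).has_min
    {I | IsTwoSidedIdeal I ∧ I ≠ ⊥ ∧ I ≤ J} ⟨J, hJ, hJ0, le_rfl⟩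
  refine ⟨S, ⟨hS, hS0, fun I hI hIS => ?_⟩, hSJ⟩
  by_cases hI0 : I = ⊥
  · exact Or.inl hI0
  · exact Or.inr (hIS.eq_or_lt.resolve_right (hmin I ⟨hI, hI0, hIS.trans hSJ⟩))

variable [IsScalarTower F A A] [SMulCommClass F A A]

/-- A semisimple algebra is the sum of its simple components. -/
theorem sSup_isSimpleComponent_eq_top (hA : IsSemisimple F A) :
    sSup {S : Submodule F A | IsSimpleComponent S} = ⊤ := by
  set I := sSup {S : Submodule F A | IsSimpleComponent S} with hI
  obtain ⟨ε, hε, hεI, hεc⟩ := (isTwoSidedIdeal_sSup fun S hS => hS.1 :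
    IsTwoSidedIdeal I).exists_unit hA
  have hideal : IsTwoSidedIdeal I := isTwoSidedIdeal_sSup fun S hS => hS.1
  -- The annihilator of `ε` is an ideal; a simple component inside it would also lie in `I`, where
  -- `ε` acts as the identity.
  have hJ : LinearMap.ker (LinearMap.mulLeft F ε) = ⊥ := by
    by_contra hJ0
    obtain ⟨S, hS, hSJ⟩ := exists_isSimpleComponent_le (J := LinearMap.ker (LinearMap.mulLeft F ε))
      (by
        intro x hx a
        have hx : ε * x = 0 := hx
        refine ⟨?_, ?_⟩
        · change ε * (a * x) = 0
          rw [← mul_assoc, hεc, mul_assoc, hx, mul_zero]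
        · change ε * (x * a) = 0
          rw [← mul_assoc, hx, zero_mul]) hJ0
    refine hS.2.1 ((Submodule.eq_bot_iff S).2 fun x hx => ?_)
    rw [← (hεI x ((le_sSup hS : S ≤ I) hx)).1]
    exact hSJ hx
  rw [eq_top_iff]
  intro x _
  have h : x - ε * x ∈ LinearMap.ker (LinearMap.mulLeft F ε) := by
    change ε * (x - ε * x) = 0
    rw [mul_sub, ← mul_assoc, (hεI ε hε).1, sub_self]
  rw [hJ, Submodule.mem_bot, sub_eq_zero] at h
  rw [h]
  exact (hideal ε hε x).2

/-- A simple component is complementary to the sum of the other ones. -/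
theorem IsSimpleComponent.isCompl (hA : IsSemisimple F A) {S : Submodule F A}
    (hS : IsSimpleComponent S) : IsCompl S (sSup {T | IsSimpleComponent T ∧ T ≠ S}) := by
  constructor
  · rw [Submodule.disjoint_def]
    intro x hxS hxT
    obtain ⟨ε, hε, hεS, -⟩ := hS.1.exists_unit hA
    have : sSup {T | IsSimpleComponent T ∧ T ≠ S} ≤ LinearMap.ker (LinearMap.mulLeft F ε) := by
      refine sSup_le fun T hT t ht => ?_
      have hbot : S ⊓ T = ⊥ := by
        have hideal : IsTwoSidedIdeal (S ⊓ T) := fun y hy a =>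
          ⟨⟨(hS.1 y hy.1 a).1, (hT.1.1 y hy.2 a).1⟩, ⟨(hS.1 y hy.1 a).2, (hT.1.1 y hy.2 a).2⟩⟩
        rcases hS.2.2 _ hideal inf_le_left with h | h
        · exact h
        rcases hT.1.2.2 _ hideal inf_le_right with h' | h'
        · exact h'
        exact absurd (h'.symm.trans h) hT.2
      have hmem : ε * t ∈ S ⊓ T := ⟨(hS.1 ε hε t).2, (hT.1.1 t ht ε).1⟩
      rw [hbot] at hmem
      exact hmem
    rw [← (hεS x hxS).1]
    exact this hxT
  · rw [codisjoint_iff, eq_top_iff, ← sSup_isSimpleComponent_eq_top hA]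
    refine sSup_le fun T hT => ?_
    by_cases h : T = S
    · exact h ▸ le_sup_left
    · exact le_sup_of_le_right (le_sSup ⟨hT, h⟩)

/-- If `e` and `f` lie in the same two-sided ideals, then their projections on each simple
component vanish simultaneously. -/
theorem IsSimpleComponent.exists_projections (hA : IsSemisimple F A) {e f : A}
    (h : ∀ I : Submodule F A, IsTwoSidedIdeal I → (e ∈ I ↔ f ∈ I)) {S : Submodule F A}
    (hS : IsSimpleComponent S) :
    ∃ e' f' : A, IsProjection S e e' ∧ IsProjection S f f' ∧ (e' = 0 ↔ f' = 0) := by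
  have hc := hS.isCompl hA
  set T := sSup {T | IsSimpleComponent T ∧ T ≠ S} with hT
  have hex : ∀ x : A, ∃ y, IsProjection S x y := by
    intro x
    have hx : x ∈ S ⊔ T := hc.sup_eq_top ▸ Submodule.mem_top
    obtain ⟨y, hy, z, hz, rfl⟩ := Submodule.mem_sup.1 hx
    exact ⟨y, hy, by rwa [add_sub_cancel_left]⟩
  have hzero : ∀ x y : A, IsProjection S x y → (y = 0 ↔ x ∈ T) := by
    rintro x y ⟨hy, hxy⟩
    constructor
    · rintro rfl
      rwa [sub_zero] at hxy
    · intro hx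
      refine Submodule.disjoint_def.1 hc.disjoint y hy ?_
      rw [← sub_sub_cancel x y]
      exact T.sub_mem hx hxy
  obtain ⟨e', he'⟩ := hex e
  obtain ⟨f', hf'⟩ := hex f
  refine ⟨e', f', he', hf', ?_⟩
  rw [hzero e e' he', hzero f f' hf']
  -- A projection on `S` vanishes exactly on the ideal `T`, so `h` is needed only there.
  exact h T (isTwoSidedIdeal_sSup fun I hI => hI.1.1)

end Components

end JordanLie

/-! ### The main theorem -/

theorem proposition4p9 {F A : Type*} [Field F] [IsAlgClosed F] (p : ℕ) [CharP F p]
    (hp2 : p ≠ 2) (hp3 : p ≠ 3)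
    [NonUnitalRing A] [Module F A] [IsScalarTower F A A] [SMulCommClass F A A]
    [FiniteDimensional F A] (hA : JordanLie.IsSemisimple F A)
    (k : ℕ) (B : Submodule F A) :
    (JordanLie.IsJordanLieInnerIdeal (JordanLie.lieDerived F A k) B ↔
      ∃ e f : A, JordanLie.IsStrictOrthogonalIdempotentPair F e f ∧
        (B : Set A) = {x | ∃ a : A, x = e * a * f}) ∧
    (JordanLie.IsJordanLieInnerIdeal (JordanLie.lieDerived F A k) B →
      JordanLie.IsRegularInnerIdeal (JordanLie.lieDerived F A k) B) := by
  have h2 : (2 : F) ≠ 0 := Ring.two_ne_zero (ringChar.eq F p ▸ hp2)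
  refine ⟨⟨fun hB => ?_, ?_⟩, fun hB => ?_⟩
  · obtain ⟨e, f, he, hf, hef, hfe, hgen, hBe⟩ := hB.exists_corner hA h2
    refine ⟨e, f, ⟨he, hf, hef, hfe, fun S hS => hS.exists_projections hA fun I hI => ?_⟩, hBe⟩
    -- An ideal containing `e` or `f` contains `B = eAf`, hence both idempotents by `hgen`.
    have hsub : e ∈ I ∨ f ∈ I → B ≤ I := by
      intro h x hx
      have hx : x ∈ {x | ∃ a : A, x = e * a * f} := hBe ▸ hx
      obtain ⟨a, rfl⟩ := hx
      rcases h with h | h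
      · exact (hI _ (hI e h a).2 f).2
      · exact (hI f h _).1
    exact ⟨fun h => (hgen I hI (hsub (Or.inl h))).2, fun h => (hgen I hI (hsub (Or.inr h))).1⟩
  · rintro ⟨e, f, ⟨he, hf, hef, hfe, -⟩, hBe⟩
    exact (JordanLie.isJordanLieInnerIdeal_of_corner hA h2 k he hf hef hfe hBe).1
  · obtain ⟨e, f, he, hf, hef, hfe, -, hBe⟩ := hB.exists_corner hA h2
    exact (JordanLie.isJordanLieInnerIdeal_of_corner hA h2 k he hf hef hfe hBe).2
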